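/- Let $X$ be a nonempty set and let $G$ be a subgroup of $\{1,-1\}^X$ that contains the constant function $-1$ and separates the points of $X$. For any group $A$, let $\chi(A)$ be the group of homomorphisms $A\to\{1,-1\}$ with the topology of pointwise convergence; identify $x\in X$ with the character $a\mapsto a(x)$ of $G$, so that $X\subseteq\chi(G)$. For $a,b\in G$ put $D(a,b)=\{c\in G:\ \forall x\in X\ (c(x)=a(x)\text{ or }c(x)=b(x))\}$. The pair $(X,G)$ is called a \emph{space of orderings} if moreover (1) every $x\in\chi(G)$ with $x(-1)=-1$ and $D(a,b)\subseteq\ker(x)$ for all $a,b\in\ker(x)$ belongs to $X$; and (2) for all $a_1,a_2,a_3,b,c\in G$ with $b\in D(a_1,c)$ and $c\in D(a_2,a_3)$ there is $d\in D(a_1,a_2)$ with $b\in D(d,a_3)$. Let $(X,G)$ be a space of orderings and let $G_0$ be a subgroup of $G$, possibly of infinite index, with $-1\in G_0$. Let $X_0=\{x|_{G_0}: x\in X\}\subseteq\chi(G_0)$, and regard $G_0$ as a group of functions $X_0\to\{1,-1\}$ by $g\mapsto(\chi\mapsto\chi(g))$; the pair $(X_0,G_0)$ is the quotient structure of $(X,G)$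 determined by $G_0$. Identify $\chi(G/G_0)$ with the group of characters of $G$ that are trivial on $G_0$, and let $$S=X^4\cap\chi(G/G_0),\qquad X^4=\{\sigma_1\sigma_2\sigma_3\sigma_4:\ \sigma_1,\dots,\sigma_4\in X\}\subseteq\chi(G)$$ (the $\sigma_i$ need not be distinct). \textbf{Theorem.} If the quotient structure $(X_0,G_0)$ is a space of orderings, then $S$ generates $\chi(G/G_0)$ as a topological group, i.e. $\chi(G/G_0)$ is the closure of the subgroup generated by $S$; equivalently, $S^\perp=G_0$, where $S^\perp=\{g\in G:\ \sigma(g)=1\text{ for all }\sigma\in S\}$. -/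

import Mathlib

namespace SpaceOfOrderings

/-- The value set `D(a, b)` of the binary form `(a, b)`, for a group `G` of functions
`X → {1, -1}`. -/
def valueSet {X : Type*} {G : Subgroup (X → ℤˣ)} (a b : G) : Set G :=
  {c | ∀ x : X, c.1 x = a.1 x ∨ c.1 x = b.1 x}

/-- `(X, G)` is a space of orderings, where `G` is a subgroup of `{1, -1}^X`. -/
structure IsSpaceOfOrderings {X : Type*} (G : Subgroup (X → ℤˣ)) : Prop where
  nonempty : Nonempty X
  neg_one_mem : -1 ∈ G
  separates : ∀ x y : X, (∀ a ∈ G, a x = a y) → x = y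
  character_mem : ∀ χ : G →* ℤˣ, χ ⟨-1, neg_one_mem⟩ = -1 →
    (∀ a ∈ χ.ker, ∀ b ∈ χ.ker, valueSet a b ⊆ (χ.ker : Set G)) →
    ∃ x : X, ∀ a : G, χ a = a.1 x
  assoc : ∀ a₁ a₂ a₃ b c : G, ∃ d : G,
    b ∈ valueSet a₁ c ∧ c ∈ valueSet a₂ a₃ → b ∈ valueSet d a₃ ∧ d ∈ valueSet a₁ a₂

/-- The character group of a (discrete) group `A`: homomorphisms `A → {1, -1}`. -/
abbrev CharGroup (A : Type*) [Group A] := A →* ℤˣ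

/-- The topology of pointwise convergence on the character group. -/
instance CharGroup.instTopologicalSpace (A : Type*) [Group A] :
    TopologicalSpace (CharGroup A) :=
  TopologicalSpace.induced (fun χ : CharGroup A => (χ : A → ℤˣ)) inferInstance

instance CharGroup.instIsTopologicalGroup (A : Type*) [Group A] :
    IsTopologicalGroup (CharGroup A) :=
  topologicalGroup_induced (MonoidHom.coeFn A ℤˣ)

/-- A point `x` of `X`, viewed as the character `a ↦ a x` of `G`. -/
def evalChar {X : Type*} (G : Subgroup (X → ℤˣ)) (x : X) : CharGroup G :=
  (Pi.evalMonoidHom (fun _ : X => ℤˣ) x).comp G.subtype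

/-- `X^k`, the set of products of `k` (not necessarily distinct) elements of `X`, in the
character group of `G`. -/
def charProducts {X : Type*} (G : Subgroup (X → ℤˣ)) (k : ℕ) : Set (CharGroup G) :=
  {γ | ∃ σ : Fin k → X, γ = ∏ i, evalChar G (σ i)}

/-- The natural embedding of the characters of `A / B` into the characters of `A`. -/
def inflate {A : Type*} [CommGroup A] (B : Subgroup A) : CharGroup (A ⧸ B) →* CharGroup A :=
  MonoidHom.compHom' (QuotientGroup.mk' B)

/-- The elements of `A` at which all characters in `S` take the value `1`. -/
def perp {A : Type*} [Group A] (S : Set (CharGroup A)) : Set A :=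
  {g | ∀ σ ∈ S, σ g = 1}

/-- The set `X₀` of restrictions of the elements of `X` to the subgroup `G₀` of `G`. -/
def restrictedPoints {X : Type*} {G : Subgroup (X → ℤˣ)} (G₀ : Subgroup G) :
    Set (CharGroup G₀) :=
  Set.range fun x : X => (evalChar G x).comp G₀.subtype

/-- The group `G₀` of the quotient structure `(X₀, G₀)`, viewed as a group of functions
`X₀ → {1, -1}` by `g ↦ (χ ↦ χ g)`. -/
def quotientStructure {X : Type*} {G : Subgroup (X → ℤˣ)} (G₀ : Subgroup G) :
    Subgroup (restrictedPoints G₀ → ℤˣ) :=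
  (MonoidHom.pi fun χ : restrictedPoints G₀ => (χ : CharGroup G₀)).range

/-- `S = X^4 ∩ χ(G / G₀)`, where the characters of `G / G₀` are regarded as characters
of `G`. -/
def quotientGenerators {X : Type*} {G : Subgroup (X → ℤˣ)} (G₀ : Subgroup G) :
    Set (CharGroup G) :=
  charProducts G 4 ∩ Set.range (inflate G₀)

end SpaceOfOrderings

/-!
The heart of the matter is the equality `S^⊥ = G₀`. View `G₀` as a group `H` of functions on `X`;
apart from separating points it satisfies the axioms of a space of orderings. Let `g ∈ G` be such
that `g σ * g τ * g ρ * g ω = 1` whenever the product of the characters `σ, τ, ρ, ω` is trivial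
on `H`. Then `g ∈ H` (`mem_of_four_products`), by the following argument.

For `A ⊆ H` let `Y` be the set of points at which all elements of `A` are `1`. If `g ∉ H`, then
Zorn's lemma provides a maximal `A` such that `g` agrees with no element of `H` on `Y`; chains are
harmless by a compactness property (`IsPreSpace.exists_mem_chain`). By maximality `g` agrees with
some element of `H` on every proper subset `{b = 1}` of `Y`, `b ∈ H`.

* *Gluing* (`IsPreSpace.exists_eqOn_of_three`). Suppose that `{b = 1} ⊆ {e = 1}` on `Y`, so that
  `Y` is the disjoint union of `{b = 1}`, `{b = -1, e = 1}` and `{e = -1}`. If `g` agrees with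
  elements of `H` on the complement of each of the three pieces, then a single application of the
  associativity axiom produces an element of `H` which agrees with `g` on all of `Y`.
* Hence there are no proper inclusions `∅ ≠ {b = 1} ⊂ {e = 1} ≠ Y`, and `Y` is a fan: the product
  of three of its points is again a point (`IsPreSpace.exists_point_mul_of_rigid`).
* On a fan the condition on products of four values forces `g` to agree with an element of `H`
  (`IsPreSpace.exists_eqOn_of_fan`), a contradiction.

That associativity holds on `Y` and that compactness is available both follow from the fact that
every preordering is an intersection of orderings (`IsPreordering.exists_point_eq_neg_one`).

The density of the subgroup generated by `S` follows from `S^⊥ = G₀` by duality for groups of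
characters with values in `{1, -1}` (`topologicalClosure_eq_top_of_separating`).
-/

namespace SpaceOfOrderings

variable {X : Type*}

/-! ### Groups of functions satisfying the axioms up to separation of points -/

theorem units_mul_eq_one_iff {u v : ℤˣ} : u * v = 1 ↔ u = v := by
  rw [mul_eq_one_iff_eq_inv, Int.units_inv_eq_self]

theorem mul_self_eq_one (a : X → ℤˣ) : a * a = 1 := funext fun _ => Int.units_mul_self _

/-- The axioms of a space of orderings, except that the functions in `H` need not separate the
points of `X`. This makes it possible to treat a quotient structure as a subgroup of `G` consisting
of functions on the same set `X`. -/
structure IsPreSpace (H : Subgroup (X → ℤˣ)) : Prop where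
  neg_one_mem : -1 ∈ H
  exists_point : ∀ χ : H →* ℤˣ, χ ⟨-1, neg_one_mem⟩ = -1 →
    (∀ a b c : H, χ a = 1 → χ b = 1 → (∀ x, c.1 x = a.1 x ∨ c.1 x = b.1 x) → χ c = 1) →
    ∃ x : X, ∀ a : H, χ a = a.1 x
  assoc : ∀ a₁ ∈ H, ∀ a₂ ∈ H, ∀ a₃ ∈ H, ∀ b ∈ H, ∀ c ∈ H,
    (∀ x, b x = a₁ x ∨ b x = c x) → (∀ x, c x = a₂ x ∨ c x = a₃ x) →
    ∃ d ∈ H, (∀ x, d x = a₁ x ∨ d x = a₂ x) ∧ ∀ x, b x = d x ∨ b x = a₃ x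

theorem IsSpaceOfOrderings.isPreSpace {G : Subgroup (X → ℤˣ)} (hG : IsSpaceOfOrderings G) :
    IsPreSpace G where
  neg_one_mem := hG.neg_one_mem
  exists_point χ h1 h2 := hG.character_mem χ h1 fun a ha b hb c hc => h2 a b c ha hb hc
  assoc a₁ h₁ a₂ h₂ a₃ h₃ b hb c hc h h' := by
    obtain ⟨d, hd⟩ := hG.assoc ⟨a₁, h₁⟩ ⟨a₂, h₂⟩ ⟨a₃, h₃⟩ ⟨b, hb⟩ ⟨c, hc⟩
    exact ⟨d, d.2, (hd ⟨h, h'⟩).2, (hd ⟨h, h'⟩).1⟩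

/-- Composition with `π : X → X'`, as a homomorphism on functions with values in `{1, -1}`. -/
def pullback {X' : Type*} (π : X → X') : (X' → ℤˣ) →* (X → ℤˣ) :=
  MonoidHom.pi fun x => Pi.evalMonoidHom (fun _ => ℤˣ) (π x)

theorem IsPreSpace.map_pullback {X' : Type*} {H : Subgroup (X' → ℤˣ)} (hH : IsPreSpace H)
    {π : X → X'} (hπ : Function.Surjective π) : IsPreSpace (H.map (pullback π)) where
  neg_one_mem := ⟨-1, hH.neg_one_mem, rfl⟩
  exists_point χ h1 h2 := by
    obtain ⟨x', hx'⟩ := hH.exists_point (χ.comp ((pullback π).subgroupMap H)) h1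
      fun a b c ha hb hc => h2 _ _ _ ha hb fun x => hc (π x)
    obtain ⟨x, rfl⟩ := hπ x'
    refine ⟨x, ?_⟩
    rintro ⟨_, a, ha, rfl⟩
    exact hx' ⟨a, ha⟩
  assoc := by
    rintro _ ⟨a₁, h₁, rfl⟩ _ ⟨a₂, h₂, rfl⟩ _ ⟨a₃, h₃, rfl⟩ _ ⟨b, hb, rfl⟩ _ ⟨c, hc, rfl⟩ h h'
    obtain ⟨d, hd, hd1, hd2⟩ := hH.assoc a₁ h₁ a₂ h₂ a₃ h₃ b hb c hc
      (hπ.forall.2 h) (hπ.forall.2 h')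
    exact ⟨_, ⟨d, hd, rfl⟩, fun x => hd1 (π x), fun x => hd2 (π x)⟩

theorem IsPreSpace.neg_mem {H : Subgroup (X → ℤˣ)} (hH : IsPreSpace H) {a : X → ℤˣ}
    (ha : a ∈ H) : -a ∈ H := by
  simpa using H.mul_mem hH.neg_one_mem ha

/-- In terms of multivalued addition: if `w ∈ (a + b) + (c + d)`, then `w ∈ (a + c) + (b + d)`. -/
theorem IsPreSpace.exchange {H : Subgroup (X → ℤˣ)} (hH : IsPreSpace H)
    {a b c d p q w : X → ℤˣ} (ha : a ∈ H) (hb : b ∈ H) (hc : c ∈ H) (hd : d ∈ H) (hp : p ∈ H)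
    (hq : q ∈ H) (hw : w ∈ H) (h : ∀ x, w x = p x ∨ w x = q x)
    (h₁ : ∀ x, p x = a x ∨ p x = b x) (h₂ : ∀ x, q x = c x ∨ q x = d x) :
    ∃ p' ∈ H, ∃ q' ∈ H, (∀ x, p' x = a x ∨ p' x = c x) ∧ (∀ x, q' x = b x ∨ q' x = d x) ∧
      ∀ x, w x = p' x ∨ w x = q' x := by
  obtain ⟨e, he, he1, he2⟩ := hH.assoc q hq a ha b hb w hw p hp (fun x => (h x).symm) h₁
  obtain ⟨p', hp', h3, h4⟩ := hH.assoc a ha c hc d hd e he q hq (fun x => (he1 x).symm) h₂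
  obtain ⟨q', hq', h5, h6⟩ := hH.assoc b hb d hd p' hp' w hw e he (fun x => (he2 x).symm)
    fun x => (h4 x).symm
  exact ⟨p', hp', q', hq', h3, h5, fun x => (h6 x).symm⟩

/-! ### Preorderings and their points -/

/-- A preordering of `H`: a subgroup `K` of `H` containing the value set in `H` of each binary form
with entries in `K`. The improper case `-1 ∈ K` is allowed. -/
structure IsPreordering (H K : Subgroup (X → ℤˣ)) : Prop where
  le : K ≤ H
  value_mem : ∀ a ∈ K, ∀ b ∈ K, ∀ c ∈ H, (∀ x, c x = a x ∨ c x = b x) → c ∈ K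

/-- The preordering `K + g K` obtained by adjoining `g` to `K`. -/
theorem IsPreordering.exists_adjoin {H K : Subgroup (X → ℤˣ)} (hH : IsPreSpace H)
    (hK : IsPreordering H K) {g : X → ℤˣ} (hg : g ∈ H) :
    ∃ K', IsPreordering H K' ∧ K ≤ K' ∧ g ∈ K' ∧
      ∀ c ∈ K', ∃ s ∈ K, ∃ t ∈ K, ∀ x, c x = s x ∨ c x = g x * t x := by
  have hgg (x) : g x * g x = 1 := Int.units_mul_self _
  refine ⟨{ carrier := {c | c ∈ H ∧ ∃ s ∈ K, ∃ t ∈ K, ∀ x, c x = s x ∨ c x = g x * t x}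
            one_mem' := ⟨H.one_mem, 1, K.one_mem, 1, K.one_mem, fun x => Or.inl rfl⟩
            inv_mem' := ?_
            mul_mem' := ?_ }, ⟨fun c hc => hc.1, ?_⟩, ?_, ?_, fun c hc => hc.2⟩
  · rintro u v ⟨hu, s, hs, t, ht, h⟩ ⟨hv, s', hs', t', ht', h'⟩
    refine ⟨H.mul_mem hu hv, ?_⟩
    -- `(s + g t)(s' + g t') ⊆ (s s' + g t s') + (t t' + g s t')`, since `g` has square `1`.
    obtain ⟨p, hp, q, hq, h1, h2, h3⟩ := hH.exchange (w := u * v) (p := u * s')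
      (q := u * (g * t')) (a := s * s') (b := g * (t * s')) (c := t * t') (d := g * (s * t'))
      (hK.le (K.mul_mem hs hs')) (H.mul_mem hg (hK.le (K.mul_mem ht hs')))
      (hK.le (K.mul_mem ht ht')) (H.mul_mem hg (hK.le (K.mul_mem hs ht')))
      (H.mul_mem hu (hK.le hs')) (H.mul_mem hu (H.mul_mem hg (hK.le ht'))) (H.mul_mem hu hv)
      (fun x => by rcases h' x with e | e <;> simp [e])
      (fun x => by rcases h x with e | e <;> simp [e, mul_assoc])
      (fun x => by
        rcases h x with e | e
        · right; simp only [Pi.mul_apply, e]; exact mul_left_comm _ _ _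
        · left
          simp only [Pi.mul_apply, e]
          rw [mul_mul_mul_comm, hgg, one_mul])
    refine ⟨p, hK.value_mem _ (K.mul_mem hs hs') _ (K.mul_mem ht ht') _ hp h1, g * q,
      hK.value_mem _ (K.mul_mem ht hs') _ (K.mul_mem hs ht') _ (H.mul_mem hg hq) fun x => ?_,
      fun x => ?_⟩
    · rcases h2 x with e | e <;> simp only [Pi.mul_apply, e, ← mul_assoc, hgg, one_mul, true_or,
        or_true]
    · simpa only [Pi.mul_apply, ← mul_assoc, hgg, one_mul] using h3 x
  · rintro u ⟨hu, h⟩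
    rw [Set.mem_ofPred_eq, inv_eq_of_mul_eq_one_left (mul_self_eq_one u)]
    exact ⟨hu, h⟩
  · rintro u ⟨hu, s, hs, t, ht, h⟩ v ⟨hv, s', hs', t', ht', h'⟩ c hc huv
    obtain ⟨p, hp, q, hq, h1, h2, h3⟩ := hH.exchange (hK.le hs) (H.mul_mem hg (hK.le ht))
      (hK.le hs') (H.mul_mem hg (hK.le ht')) hu hv hc huv h h'
    refine ⟨hc, p, hK.value_mem _ hs _ hs' _ hp h1, g * q,
      hK.value_mem _ ht _ ht' _ (H.mul_mem hg hq) fun x => ?_, fun x => ?_⟩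
    · rcases h2 x with e | e <;> simp only [Pi.mul_apply, e, ← mul_assoc, hgg, one_mul, true_or,
        or_true]
    · simpa only [Pi.mul_apply, ← mul_assoc, hgg, one_mul] using h3 x
  · exact fun c hc => ⟨hK.le hc, c, hc, 1, K.one_mem, fun x => Or.inl rfl⟩
  · exact ⟨hg, 1, K.one_mem, 1, K.one_mem, fun x => Or.inr (by simp)⟩

/-- A proper preordering `M` with `M ∪ -M = H` is the kernel of a point. -/
theorem IsPreSpace.exists_point_of_isPreordering {H M : Subgroup (X → ℤˣ)} (hH : IsPreSpace H)
    (hM : IsPreordering H M) (h1 : -1 ∉ M) (h2 : ∀ g ∈ H, g ∈ M ∨ -g ∈ M) :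
    ∃ x, ∀ g ∈ H, g ∈ M ↔ g x = 1 := by
  classical
  have h3 : ∀ g, g ∈ M → -g ∉ M := fun g hg hg' => h1 (by
    have := M.mul_mem hg hg'
    have e : g * -g = -1 := by rw [mul_neg, mul_self_eq_one]
    rwa [e] at this)
  let χ : H →* ℤˣ :=
    { toFun := fun g => if g.1 ∈ M then 1 else -1
      map_one' := if_pos M.one_mem
      map_mul' := fun a b => by
        rcases h2 a a.2 with ha | ha <;> rcases h2 b b.2 with hb | hb
        · simp [ha, hb, M.mul_mem ha hb]
        · have := M.mul_mem ha hb
          rw [mul_neg] at this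
          have h4 := h3 _ this
          have h5 := h3 _ hb
          rw [neg_neg] at h4 h5
          simp [ha, h5, h4]
        · have := M.mul_mem ha hb
          rw [neg_mul] at this
          have h4 := h3 _ this
          have h5 := h3 _ ha
          rw [neg_neg] at h4 h5
          simp [hb, h5, h4]
        · have := M.mul_mem ha hb
          rw [neg_mul_neg] at this
          have h4 := h3 _ ha
          have h5 := h3 _ hb
          rw [neg_neg] at h4 h5
          simp [h5, h4, this] }
  have hχ : ∀ g : H, χ g = 1 ↔ g.1 ∈ M := fun g => by
    by_cases h : g.1 ∈ M <;> simp [χ, h]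
  obtain ⟨x, hx⟩ := hH.exists_point χ (if_neg h1) fun a b c ha hb hc =>
    (hχ c).2 (hM.value_mem _ ((hχ a).1 ha) _ ((hχ b).1 hb) _ c.2 hc)
  exact ⟨x, fun g hg => by rw [← hχ ⟨g, hg⟩, hx]⟩

/-- An element `c` of `H` outside the preordering `K` is negative at some point that is positive
on `K`: a preordering that is maximal with respect to not containing `c` is the kernel of such a
point. -/
theorem IsPreordering.exists_point_eq_neg_one {H K : Subgroup (X → ℤˣ)} (hH : IsPreSpace H)
    (hK : IsPreordering H K) {c : X → ℤˣ} (hc : c ∈ H) (hcK : c ∉ K) :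
    ∃ x, (∀ h ∈ K, h x = 1) ∧ c x = -1 := by
  obtain ⟨M, hKM, ⟨hM, hcM⟩, hmax⟩ := zorn_le_nonempty₀
    {M : Subgroup (X → ℤˣ) | IsPreordering H M ∧ c ∉ M} (fun C hC hchain M₀ hM₀ => by
      have hmem : ∀ {y}, y ∈ sSup C ↔ ∃ M ∈ C, y ∈ M := fun {y} =>
        Subgroup.mem_sSup_of_directedOn ⟨M₀, hM₀⟩ hchain.directedOn
      refine ⟨sSup C, ⟨⟨sSup_le fun M hM => (hC hM).1.le, fun a ha b hb e he h => ?_⟩,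
        fun h => ?_⟩, fun M hM => le_sSup hM⟩
      · obtain ⟨M₁, h₁, ha⟩ := hmem.1 ha
        obtain ⟨M₂, h₂, hb⟩ := hmem.1 hb
        obtain ⟨M, hM, h₁', h₂'⟩ := hchain.directedOn _ h₁ _ h₂
        exact hmem.2 ⟨M, hM, (hC hM).1.value_mem _ (h₁' ha) _ (h₂' hb) _ he h⟩
      · obtain ⟨M, hM, h⟩ := hmem.1 h
        exact (hC hM).2 h) K ⟨hK, hcK⟩
  have key : ∀ g ∈ H, g ∉ M → ∃ s ∈ M, ∃ t ∈ M, ∀ x, c x = s x ∨ c x = g x * t x := by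
    intro g hg hgM
    obtain ⟨K', hK', hle, hgK', h⟩ := hM.exists_adjoin hH hg
    by_contra hcon
    exact hgM (hmax ⟨hK', fun hcK' => hcon (h c hcK')⟩ hle hgK')
  have hcneg : -c ∈ M := by
    by_contra hn
    obtain ⟨s, hs, t, ht, h⟩ := key _ (hH.neg_mem hc) hn
    refine hcM (hM.value_mem s hs (s * t) (M.mul_mem hs ht) c hc fun x => ?_)
    rcases h x with e | e
    · exact Or.inl e
    · rcases Int.units_eq_one_or (c x) with h1 | h1 <;>
        rcases Int.units_eq_one_or (s x) with h2 | h2 <;>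
        rcases Int.units_eq_one_or (t x) with h3 | h3 <;> simp_all
  have h1 : -1 ∉ M := fun h => hcM (by simpa using M.mul_mem h hcneg)
  have h2 : ∀ g ∈ H, g ∈ M ∨ -g ∈ M := fun g hg => by
    by_contra! hcon
    obtain ⟨s, hs, t, ht, h⟩ := key g hg hcon.1
    -- Multiplying `c ∈ s + g t` by `-c` gives `-1 ∈ -c s - k` with `k = g c t`. Hence `k` lies in
    -- `1 - c s`, and this is a subset of `M` because `-c ∈ M`.
    have : -g * (-c * t) ∈ M := by
      refine hM.value_mem 1 M.one_mem (-c * s) (M.mul_mem hcneg hs) _ (H.mul_mem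
        (hH.neg_mem hg) (hM.le (M.mul_mem hcneg ht))) fun x => ?_
      have := h x
      rcases Int.units_eq_one_or (c x) with h1 | h1 <;>
        rcases Int.units_eq_one_or (s x) with h2 | h2 <;>
        rcases Int.units_eq_one_or (t x) with h3 | h3 <;>
        rcases Int.units_eq_one_or (g x) with h4 | h4 <;> simp_all
    refine hcon.2 ?_
    have := M.mul_mem this (M.mul_mem hcneg ht)
    have e : -g * (-c * t) * (-c * t) = -g := by
      rw [mul_assoc, mul_self_eq_one, mul_one]
    rwa [e] at this
  obtain ⟨x, hx⟩ := hH.exists_point_of_isPreordering hM h1 h2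
  refine ⟨x, fun h hh => (hx h (hK.le hh)).1 (hKM hh), ?_⟩
  exact (Int.units_eq_one_or _).resolve_left fun h => hcM ((hx c hc).2 h)

/-! ### Subspaces -/

/-- The points at which all functions in `A` take the value `1`. -/
def points (A : Set (X → ℤˣ)) : Set X := {x | ∀ h ∈ A, h x = 1}

/-- The subgroup of all elements of `H` that take the value `1` everywhere on `Y`. -/
def vanishing (H : Subgroup (X → ℤˣ)) (Y : Set X) : Subgroup (X → ℤˣ) where
  carrier := {h | h ∈ H ∧ ∀ x ∈ Y, h x = 1}
  one_mem' := ⟨H.one_mem, fun _ _ => rfl⟩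
  mul_mem' := fun ha hb => ⟨H.mul_mem ha.1 hb.1, fun x hx => by simp [ha.2 x hx, hb.2 x hx]⟩
  inv_mem' := fun ha => ⟨H.inv_mem ha.1, fun x hx => by simp [ha.2 x hx]⟩

theorem isPreordering_vanishing (H : Subgroup (X → ℤˣ)) (Y : Set X) :
    IsPreordering H (vanishing H Y) where
  le _ h := h.1
  value_mem a ha b hb c hc h := ⟨hc, fun x hx => by
    rcases h x with e | e
    · exact e.trans (ha.2 x hx)
    · exact e.trans (hb.2 x hx)⟩

/-- A form of compactness: an element of `G` that is `1` on the intersection of a chain of subspaces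
is already `1` on a member of the chain. The reason is that the elements that are `1` on some
member of the chain form a preordering. -/
theorem IsPreSpace.exists_mem_chain {G : Subgroup (X → ℤˣ)} (hG : IsPreSpace G)
    {C : Set (Set (X → ℤˣ))} (hC : IsChain (· ⊆ ·) C) (hne : C.Nonempty)
    (hCG : ∀ A ∈ C, A ⊆ G) {g : X → ℤˣ} (hg : g ∈ G) (h : ∀ x ∈ points (⋃₀ C), g x = 1) :
    ∃ A ∈ C, ∀ x ∈ points A, g x = 1 := by
  have hdir : DirectedOn (· ≤ ·) ((fun A => vanishing G (points A)) '' C) := by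
    rintro _ ⟨A, hA, rfl⟩ _ ⟨B, hB, rfl⟩
    have mono : ∀ {A B : Set (X → ℤˣ)}, A ⊆ B →
        vanishing G (points A) ≤ vanishing G (points B) := fun hAB k hk =>
      ⟨hk.1, fun x hx => hk.2 x fun k hk => hx k (hAB hk)⟩
    rcases hC.total hA hB with hAB | hAB
    · exact ⟨_, ⟨B, hB, rfl⟩, mono hAB, le_rfl⟩
    · exact ⟨_, ⟨A, hA, rfl⟩, le_rfl, mono hAB⟩
  set U := sSup ((fun A => vanishing G (points A)) '' C) with hU
  have hmem : ∀ {y}, y ∈ U ↔ ∃ A ∈ C, y ∈ vanishing G (points A) := fun {y} => by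
    rw [hU, Subgroup.mem_sSup_of_directedOn (hne.image _) hdir]
    simp
  have hUpre : IsPreordering G U := by
    refine ⟨fun y hy => ?_, fun a ha b hb c hc habc => ?_⟩
    · obtain ⟨A, _, hA⟩ := hmem.1 hy
      exact hA.1
    · rw [hU, Subgroup.mem_sSup_of_directedOn (hne.image _) hdir] at ha hb
      obtain ⟨K₁, h₁, ha⟩ := ha
      obtain ⟨K₂, h₂, hb⟩ := hb
      obtain ⟨_, ⟨A, hA, rfl⟩, l₁, l₂⟩ := hdir _ h₁ _ h₂
      exact hmem.2 ⟨A, hA, (isPreordering_vanishing G _).value_mem _ (l₁ ha) _ (l₂ hb) _ hc habc⟩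
  have hgU : g ∈ U := by
    by_contra hgU
    obtain ⟨x, hx, hgx⟩ := hUpre.exists_point_eq_neg_one hG hg hgU
    have := h x fun k ⟨A, hA, hk⟩ =>
      hx k (hmem.2 ⟨A, hA, hCG A hA hk, fun y hy => hy k hk⟩)
    rw [this] at hgx
    exact absurd hgx (by decide)
  obtain ⟨A, hA, hgA⟩ := hmem.1 hgU
  exact ⟨A, hA, hgA.2⟩

/-- If `c` is a value of the form `(a, b)` on a subspace, then `c` is a value on all of `X` of a
form `(a s, b t)` where `s` and `t` are `1` on the subspace. -/
theorem IsPreSpace.exists_value_of_forall_points {H : Subgroup (X → ℤˣ)} (hH : IsPreSpace H)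
    {A : Set (X → ℤˣ)} (hA : A ⊆ H) {a b c : X → ℤˣ} (ha : a ∈ H) (hb : b ∈ H) (hc : c ∈ H)
    (h : ∀ x ∈ points A, c x = a x ∨ c x = b x) :
    ∃ s ∈ vanishing H (points A), ∃ t ∈ vanishing H (points A),
      ∀ x, c x = a x * s x ∨ c x = b x * t x := by
  obtain ⟨K', hK', hle, hbK', hval⟩ := (isPreordering_vanishing H (points A)).exists_adjoin hH
    (H.mul_mem ha hb)
  have hcK' : a * c ∈ K' := by
    by_contra hn
    obtain ⟨x, hx, hcx⟩ := hK'.exists_point_eq_neg_one hH (H.mul_mem ha hc) hn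
    have h1 := h x fun k hk => hx k (hle ⟨hA hk, fun y hy => hy k hk⟩)
    have h2 := hx _ hbK'
    rw [Pi.mul_apply, units_mul_eq_one_iff] at h2
    rw [← h2, or_self] at h1
    rw [Pi.mul_apply, h1, Int.units_mul_self] at hcx
    exact absurd hcx (by decide)
  obtain ⟨s, hs, t, ht, hst⟩ := hval _ hcK'
  refine ⟨s, hs, t, ht, fun x => (hst x).imp (fun e => ?_) fun e => ?_⟩
  · rw [← e, Pi.mul_apply, ← mul_assoc, Int.units_mul_self, one_mul]
  · rw [Pi.mul_apply, Pi.mul_apply, mul_assoc] at e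
    exact mul_left_cancel e

/-- The associativity axiom on a subspace. -/
theorem IsPreSpace.assoc_points {H : Subgroup (X → ℤˣ)} (hH : IsPreSpace H)
    {A : Set (X → ℤˣ)} (hA : A ⊆ H) {a₁ a₂ a₃ b c : X → ℤˣ} (h₁ : a₁ ∈ H) (h₂ : a₂ ∈ H)
    (h₃ : a₃ ∈ H) (hb : b ∈ H) (hc : c ∈ H) (h : ∀ x ∈ points A, b x = a₁ x ∨ b x = c x)
    (h' : ∀ x ∈ points A, c x = a₂ x ∨ c x = a₃ x) :
    ∃ d ∈ H, ∀ x ∈ points A, (d x = a₁ x ∨ d x = a₂ x) ∧ (b x = d x ∨ b x = a₃ x) := by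
  obtain ⟨s, hs, t, ht, hst⟩ := hH.exists_value_of_forall_points hA h₁ hc hb h
  obtain ⟨u, hu, v, hv, huv⟩ := hH.exists_value_of_forall_points hA h₂ h₃ hc h'
  obtain ⟨d, hd, hd1, hd2⟩ := hH.assoc (a₁ * s) (H.mul_mem h₁ hs.1) (a₂ * u * t)
    (H.mul_mem (H.mul_mem h₂ hu.1) ht.1) (a₃ * v * t) (H.mul_mem (H.mul_mem h₃ hv.1) ht.1)
    b hb (c * t) (H.mul_mem hc ht.1) hst
    (fun x => (huv x).imp (fun e => by simp [e]) fun e => by simp [e])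
  refine ⟨d, hd, fun x hx => ⟨?_, ?_⟩⟩
  · simpa [hs.2 x hx, hu.2 x hx, ht.2 x hx] using hd1 x
  · simpa [hv.2 x hx, ht.2 x hx] using hd2 x

/-! ### The criterion by products of four values -/

/-- Gluing over a partition into three pieces: the subspace is the disjoint union of `{b = 1}`,
`{b = -1, e = 1}` and `{e = -1}`, and `g` agrees with `z₁`, `z₂`, `z₃` on the complements of the
first, the second and the third piece. -/
theorem IsPreSpace.exists_eqOn_of_three {H : Subgroup (X → ℤˣ)} (hH : IsPreSpace H)
    {A : Set (X → ℤˣ)} (hA : A ⊆ H) {g b e z₁ z₂ z₃ : X → ℤˣ} (hb : b ∈ H) (he : e ∈ H)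
    (hz₁ : z₁ ∈ H) (hz₂ : z₂ ∈ H) (hz₃ : z₃ ∈ H)
    (hbe : ∀ x ∈ points A, b x = 1 → e x = 1)
    (h₁ : ∀ x ∈ points A, b x = -1 → g x = z₁ x)
    (h₂ : ∀ x ∈ points A, b x = e x → g x = z₂ x)
    (h₃ : ∀ x ∈ points A, e x = 1 → g x = z₃ x) :
    ∃ h ∈ H, ∀ x ∈ points A, g x = h x := by
  -- The function `g * z₃` is `1` on `{e = 1}` and equal to both `z₁ * z₃` and `z₂ * z₃` on
  -- `{e = -1}`. Any `d ∈ D(z₁ * z₃, z₂ * z₃)` with `1 ∈ D(d, -e)` has the same two properties, and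
  -- `b * e` witnesses the hypotheses of associativity, which provides such a `d`.
  obtain ⟨d, hd, hd'⟩ := hH.assoc_points hA (a₁ := z₁ * z₃) (a₂ := z₂ * z₃) (a₃ := -e) (b := 1)
    (c := b * e) (H.mul_mem hz₁ hz₃) (H.mul_mem hz₂ hz₃) (hH.neg_mem he) H.one_mem
    (H.mul_mem hb he)
    (fun x hx => by
      have := hbe x hx; have := h₁ x hx; have := h₂ x hx; have := h₃ x hx
      rcases Int.units_eq_one_or (b x) with h4 | h4 <;>
        rcases Int.units_eq_one_or (e x) with h5 | h5 <;> simp_all)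
    (fun x hx => by
      have := hbe x hx; have := h₁ x hx; have := h₂ x hx; have := h₃ x hx
      rcases Int.units_eq_one_or (b x) with h4 | h4 <;>
        rcases Int.units_eq_one_or (e x) with h5 | h5 <;> simp_all)
  refine ⟨d * z₃, H.mul_mem hd hz₃, fun x hx => ?_⟩
  rw [← units_mul_eq_one_iff, Pi.mul_apply, ← mul_assoc, mul_right_comm, units_mul_eq_one_iff]
  have := hbe x hx; have := h₁ x hx; have := h₂ x hx; have := h₃ x hx; have := hd' x hx
  rcases Int.units_eq_one_or (b x) with h4 | h4 <;>
    rcases Int.units_eq_one_or (e x) with h5 | h5 <;> simp_all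

/-- If there are no proper inclusions `∅ ≠ {b = 1} ⊂ {e = 1} ≠ Y` on a subspace `Y`, then `Y` is a
fan: binary value sets over `Y` are as small as possible, so the character `σ τ ρ` satisfies the
condition of the character axiom. -/
theorem IsPreSpace.exists_point_mul_of_rigid {H : Subgroup (X → ℤˣ)} (hH : IsPreSpace H)
    {A : Set (X → ℤˣ)} (hA : A ⊆ H)
    (rigid : ∀ b ∈ H, ∀ e ∈ H, (∀ x ∈ points A, b x = 1 → e x = 1) →
      (∃ y ∈ points A, b y = 1) → (∀ x ∈ points A, e x = 1) ∨ ∀ x ∈ points A, e x = b x)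
    {σ τ ρ : X} (hσ : σ ∈ points A) (hτ : τ ∈ points A) (hρ : ρ ∈ points A) :
    ∃ ω ∈ points A, ∀ h ∈ H, h ω = h σ * h τ * h ρ := by
  let ev (x : X) : H →* ℤˣ := (Pi.evalMonoidHom (fun _ : X => ℤˣ) x).comp H.subtype
  have hev : ∀ a : H, (ev σ * ev τ * ev ρ) a = a.1 σ * a.1 τ * a.1 ρ := fun a => rfl
  have hvan : ∀ a : X → ℤˣ, (∀ x ∈ points A, a x = 1) → a σ * a τ * a ρ = 1 := fun a ha => by
    simp [ha σ hσ, ha τ hτ, ha ρ hρ]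
  have hsplit : ∀ c k : X → ℤˣ, k σ * k τ * k ρ = 1 → (∀ x ∈ points A, c x = k x) →
      c σ * c τ * c ρ = 1 := fun c k hk hck => by
    rw [hck σ hσ, hck τ hτ, hck ρ hρ, hk]
  obtain ⟨ω, hω⟩ := hH.exists_point (ev σ * ev τ * ev ρ) (by simp [hev]) (by
    intro a b c ha hb hc
    rw [hev] at ha hb ⊢
    have hab : ∃ y ∈ points A, (a.1 * b.1) y = 1 := by
      -- Otherwise `a = -b` on the points of `A`, and `σ τ ρ` would take opposite values at `a`, `b`.
      by_contra! hcon
      have h2 : a.1 σ * a.1 τ * a.1 ρ = -(b.1 σ * b.1 τ * b.1 ρ) := by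
        have h3 : ∀ x ∈ points A, a.1 x = -b.1 x := fun x hx => by
          have h2 := (Int.units_eq_one_or _).resolve_left (hcon x hx)
          rw [Pi.mul_apply, ← neg_eq_iff_eq_neg, ← mul_neg, units_mul_eq_one_iff] at h2
          exact h2
        rw [h3 σ hσ, h3 τ hτ, h3 ρ hρ, neg_mul_neg, mul_neg]
      rw [ha, hb] at h2
      exact absurd h2 (by decide)
    rcases rigid (a.1 * b.1) (H.mul_mem a.2 b.2) (a.1 * c.1) (H.mul_mem a.2 c.2)
      (fun x _ h => by
        rw [Pi.mul_apply, units_mul_eq_one_iff] at h ⊢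
        rcases hc x with e | e
        · exact e.symm
        · exact h.trans e.symm) hab with h | h
    · exact hsplit c.1 a.1 ha fun x hx => (units_mul_eq_one_iff.1 (h x hx)).symm
    · exact hsplit c.1 b.1 hb fun x hx => mul_left_cancel (h x hx))
  refine ⟨ω, fun k hk => ?_, fun h hh => (hω ⟨h, hh⟩).symm⟩
  have := hω ⟨k, hA hk⟩
  rw [hev] at this
  exact this.symm.trans (hvan k fun x hx => hx k hk)

/-- On a fan `Y`, the function `g` agrees with an element of `H` if it does so on every proper
subset `{b = 1}` and satisfies the condition on products of four values. -/
theorem IsPreSpace.exists_eqOn_of_fan {H : Subgroup (X → ℤˣ)} (hH : IsPreSpace H)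
    {Y : Set X} {g : X → ℤˣ}
    (local_eq : ∀ b ∈ H, (∃ y ∈ Y, b y ≠ 1) → ∃ u ∈ H, ∀ x ∈ Y, b x = 1 → g x = u x)
    (rigid : ∀ b ∈ H, ∀ e ∈ H, (∀ x ∈ Y, b x = 1 → e x = 1) →
      (∃ y ∈ Y, b y = 1) → (∀ x ∈ Y, e x = 1) ∨ ∀ x ∈ Y, e x = b x)
    (fan : ∀ σ ∈ Y, ∀ τ ∈ Y, ∀ ρ ∈ Y, ∃ ω ∈ Y, ∀ h ∈ H, h ω = h σ * h τ * h ρ)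
    (hprod : ∀ σ τ ρ ω : X, (∀ h ∈ H, h σ * h τ * h ρ * h ω = 1) →
      g σ * g τ * g ρ * g ω = 1) : ∃ h ∈ H, ∀ x ∈ Y, g x = h x := by
  by_cases hconst : ∃ b ∈ H, ∃ y₁ ∈ Y, ∃ y₂ ∈ Y, b y₁ = 1 ∧ b y₂ = -1
  · obtain ⟨b, hb, y₁, hy₁, y₂, hy₂, hby₁, hby₂⟩ := hconst
    obtain ⟨u, hu, hgu⟩ := local_eq b hb ⟨y₂, hy₂, by simp [hby₂]⟩
    obtain ⟨v, hv, hgv⟩ := local_eq (-b) (hH.neg_mem hb) ⟨y₁, hy₁, by simp [hby₁]⟩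
    replace hgv : ∀ x ∈ Y, b x = -1 → g x = v x := fun x hx h => hgv x hx (by simp [h])
    -- `u * v` is constant on `{b = 1}`: in the quadruple `σ, y₁, y₂, σ y₁ y₂` the first two points
    -- lie in `{b = 1}`, where `g = u`, and the last two in `{b = -1}`, where `g = v`.
    have huv : ∀ x ∈ Y, b x = 1 → u x * v x = u y₁ * v y₁ := by
      intro σ hσ hbσ
      obtain ⟨ω, hωY, hω⟩ := fan σ hσ y₁ hy₁ y₂ hy₂
      have h1 := hprod σ y₁ y₂ ω fun h hh => by rw [hω h hh, Int.units_mul_self]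
      have hbω : b ω = -1 := by rw [hω b hb, hbσ, hby₁, hby₂]; rfl
      rw [hgu σ hσ hbσ, hgu y₁ hy₁ hby₁, hgv y₂ hy₂ hby₂, hgv ω hωY hbω, hω v hv] at h1
      have h2 : u σ * v σ * (u y₁ * v y₁) * (v y₂ * v y₂) = 1 := by
        rw [← h1]
        ac_rfl
      rwa [Int.units_mul_self, mul_one, units_mul_eq_one_iff] at h2
    -- Hence `u * v * ε` is `1` or `b` on `Y` for the constant sign `ε`, and `g` is `u` or `u * b`.
    have key : ∀ ε : ℤˣ, (∀ x ∈ Y, v x = ε * u x) ∨ (∀ x ∈ Y, v x = ε * u x * b x) →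
        (∀ x ∈ Y, g x = u x) ∨ ∀ x ∈ Y, g x = u x * b x := by
      rintro ε (h | h) <;> rcases Int.units_eq_one_or ε with rfl | rfl
      · exact Or.inl fun x hx => by
          rcases Int.units_eq_one_or (b x) with hb | hb
          · exact hgu x hx hb
          · rw [hgv x hx hb, h x hx, one_mul]
      · exact Or.inr fun x hx => by
          rcases Int.units_eq_one_or (b x) with hb | hb
          · rw [hgu x hx hb, hb, mul_one]
          · rw [hgv x hx hb, h x hx, hb, mul_comm]
      · exact Or.inr fun x hx => by
          rcases Int.units_eq_one_or (b x) with hb | hb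
          · rw [hgu x hx hb, hb, mul_one]
          · rw [hgv x hx hb, h x hx, one_mul]
      · exact Or.inl fun x hx => by
          rcases Int.units_eq_one_or (b x) with hb | hb
          · exact hgu x hx hb
          · rw [hgv x hx hb, h x hx, hb, neg_one_mul, neg_mul_neg, mul_one]
    let ε : ℤˣ := u y₁ * v y₁
    have hεH : (fun x => ε * (u x * v x)) ∈ H := by
      rcases Int.units_eq_one_or ε with h | h
      · simp only [h, one_mul]
        exact H.mul_mem hu hv
      · simp only [h, neg_one_mul]
        exact hH.neg_mem (H.mul_mem hu hv)
    have hcase := key ε <| (rigid b hb _ hεH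
      (fun x hx h => by rw [huv x hx h, Int.units_mul_self]) ⟨y₁, hy₁, hby₁⟩).imp
        (fun h x hx => by
          have h1 := h x hx
          rw [← mul_assoc, units_mul_eq_one_iff] at h1
          exact h1.symm)
        (fun h x hx => by
          rw [← h x hx, mul_mul_mul_comm, ← mul_assoc, Int.units_mul_self, one_mul, ← mul_assoc,
            Int.units_mul_self, one_mul])
    rcases hcase with h | h
    · exact ⟨u, hu, h⟩
    · exact ⟨u * b, H.mul_mem hu hb, h⟩
  · have hgc : ∀ σ ∈ Y, ∀ τ ∈ Y, g σ = g τ := by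
      intro σ hσ τ hτ
      have := hprod σ τ τ τ fun h hh => by
        have : h σ = h τ := by
          rcases Int.units_eq_one_or (h σ) with h4 | h4 <;>
            rcases Int.units_eq_one_or (h τ) with h5 | h5
          · exact h4.trans h5.symm
          · exact absurd ⟨h, hh, σ, hσ, τ, hτ, h4, h5⟩ hconst
          · exact absurd ⟨h, hh, τ, hτ, σ, hσ, h5, h4⟩ hconst
          · exact h4.trans h5.symm
        rw [this, Int.units_mul_self, one_mul, Int.units_mul_self]
      rwa [mul_assoc, Int.units_mul_self, mul_one, units_mul_eq_one_iff] at this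
    rcases Y.eq_empty_or_nonempty with rfl | ⟨y, hy⟩
    · exact ⟨1, H.one_mem, by simp⟩
    · rcases Int.units_eq_one_or (g y) with hgy | hgy
      · exact ⟨1, H.one_mem, fun x hx => (hgc x hx y hy).trans hgy⟩
      · exact ⟨-1, hH.neg_one_mem, fun x hx => (hgc x hx y hy).trans hgy⟩

/-- Let `H ≤ G`. An element `g` of `G` belongs to `H` if it has product `1` over all quadruples of
points over which all elements of `H` have product `1`. -/
theorem mem_of_four_products {G H : Subgroup (X → ℤˣ)} (hG : IsPreSpace G) (hH : IsPreSpace H)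
    (hHG : H ≤ G) {g : X → ℤˣ} (hg : g ∈ G)
    (hprod : ∀ σ τ ρ ω : X, (∀ h ∈ H, h σ * h τ * h ρ * h ω = 1) →
      g σ * g τ * g ρ * g ω = 1) : g ∈ H := by
  by_contra hgH
  obtain ⟨A, -, ⟨hAH, hA⟩, hmax⟩ := zorn_subset_nonempty
    {A : Set (X → ℤˣ) | A ⊆ H ∧ ¬ ∃ h ∈ H, ∀ x ∈ points A, g x = h x} (fun C hC hchain hne => by
      refine ⟨⋃₀ C, ⟨Set.sUnion_subset fun A hA => (hC hA).1, ?_⟩, fun A hA =>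
        Set.subset_sUnion_of_mem hA⟩
      rintro ⟨h, hh, hgh⟩
      obtain ⟨A, hA, hA'⟩ := hG.exists_mem_chain hchain hne
        (fun A hA => (hC hA).1.trans hHG) (G.mul_mem hg (hHG hh)) (fun x hx => by
          simp [hgh x hx])
      refine (hC hA).2 ⟨h, hh, fun x hx => ?_⟩
      have := hA' x hx
      rwa [Pi.mul_apply, units_mul_eq_one_iff] at this)
    ∅ ⟨Set.empty_subset _, fun ⟨h, hh, hgh⟩ => hgH (by
      have : g = h := funext fun x => hgh x (by simp [points])
      rwa [this])⟩
  have local_eq : ∀ b ∈ H, (∃ y ∈ points A, b y ≠ 1) →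
      ∃ u ∈ H, ∀ x ∈ points A, b x = 1 → g x = u x := by
    rintro b hb ⟨y, hy, hby⟩
    by_contra hcon
    have hmem := hmax (y := insert b A) ⟨Set.insert_subset hb hAH, fun ⟨u, hu, hgu⟩ =>
      hcon ⟨u, hu, fun x hx hbx => hgu x fun k hk => ?_⟩⟩ (Set.subset_insert b A)
        (Set.mem_insert b A)
    · exact hby (hy b hmem)
    · rcases hk with rfl | hk
      · exact hbx
      · exact hx k hk
  -- An intermediate set `{e = 1}` would give a partition into three non-empty pieces, and gluing
  -- would contradict the choice of `A`.
  have rigid : ∀ b ∈ H, ∀ e ∈ H, (∀ x ∈ points A, b x = 1 → e x = 1) →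
      (∃ y ∈ points A, b y = 1) → (∀ x ∈ points A, e x = 1) ∨ ∀ x ∈ points A, e x = b x := by
    intro b hb e he hbe ⟨y, hy, hby⟩
    by_contra! hcon
    obtain ⟨⟨y₁, hy₁, hey₁⟩, y₂, hy₂, hey₂⟩ := hcon
    obtain ⟨z₁, hz₁, h₁⟩ := local_eq (-b) (hH.neg_mem hb) ⟨y, hy, by simp [hby]⟩
    obtain ⟨z₂, hz₂, h₂⟩ := local_eq (b * e) (H.mul_mem hb he) ⟨y₂, hy₂, fun h => hey₂ (by
      rw [Pi.mul_apply, units_mul_eq_one_iff] at h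
      exact h.symm)⟩
    obtain ⟨z₃, hz₃, h₃⟩ := local_eq e he ⟨y₁, hy₁, hey₁⟩
    exact hA (hH.exists_eqOn_of_three hAH hb he hz₁ hz₂ hz₃ hbe
      (fun x hx h => h₁ x hx (by simp [h])) (fun x hx h => h₂ x hx (by simp [h])) h₃)
  exact hA (hH.exists_eqOn_of_fan local_eq rigid (fun σ hσ τ hτ ρ hρ =>
    hH.exists_point_mul_of_rigid hAH rigid hσ hτ hρ) hprod)

/-! ### Duality for groups of characters -/

/-- If the characters in `C` separate the elements of `A`, then for a finite set `F` an element that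
is annihilated by every character in `C` annihilating `F` lies in the subgroup generated by `F`. -/
theorem mem_closure_of_forall_char {A : Type*} [Group A] (C : Subgroup (CharGroup A))
    (hC : ∀ a : A, (∀ γ ∈ C, γ a = 1) → a = 1) (F : Finset A) :
    ∀ a : A, (∀ γ ∈ C, (∀ b ∈ F, γ b = 1) → γ a = 1) → a ∈ Subgroup.closure (F : Set A) := by
  classical
  induction F using Finset.induction_on with
  | empty =>
    intro a ha
    rw [hC a fun γ hγ => ha γ hγ (by simp)]
    exact one_mem _
  | insert b F _ ih =>
    intro a ha
    have hle : Subgroup.closure (F : Set A) ≤ Subgroup.closure ((insert b F : Finset A) : Set A) :=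
      Subgroup.closure_mono (by simp)
    have hb : b ∈ Subgroup.closure ((insert b F : Finset A) : Set A) :=
      Subgroup.subset_closure (by simp)
    by_cases h : ∀ γ ∈ C, (∀ b ∈ F, γ b = 1) → γ b = 1
    · exact hle (ih a fun γ hγ hF => ha γ hγ fun c hc => by
        rcases Finset.mem_insert.1 hc with rfl | hc
        · exact h γ hγ hF
        · exact hF c hc)
    · push Not at h
      obtain ⟨γ₀, hγ₀, hF₀, hb₀⟩ := h
      replace hb₀ := (Int.units_eq_one_or _).resolve_left hb₀
      have key : ∀ γ ∈ C, (∀ b ∈ F, γ b = 1) → γ b = -1 → γ a * γ₀ a = 1 := fun γ hγ hF hγb =>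
        ha (γ * γ₀) (C.mul_mem hγ hγ₀) fun c hc => by
          rcases Finset.mem_insert.1 hc with rfl | hc
          · simp [hγb, hb₀]
          · simp [hF c hc, hF₀ c hc]
      have key' : ∀ γ ∈ C, (∀ b ∈ F, γ b = 1) → γ b = 1 → γ a = 1 := fun γ hγ hF hγb =>
        ha γ hγ fun c hc => by
          rcases Finset.mem_insert.1 hc with rfl | hc
          · exact hγb
          · exact hF c hc
      rcases Int.units_eq_one_or (γ₀ a) with h₀ | h₀
      · refine hle (ih a fun γ hγ hF => ?_)
        rcases Int.units_eq_one_or (γ b) with hγb | hγb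
        · exact key' γ hγ hF hγb
        · simpa [h₀] using key γ hγ hF hγb
      · have := hle (ih (a * b) fun γ hγ hF => by
          rcases Int.units_eq_one_or (γ b) with hγb | hγb
          · simp [key' γ hγ hF hγb, hγb]
          · simpa [h₀, hγb] using key γ hγ hF hγb)
        exact (Subgroup.mul_mem_cancel_right _ hb).1 this

/-- A separating group of characters interpolates every character on every finite set. -/
theorem exists_mem_eqOn_finset {A : Type*} [Group A] (C : Subgroup (CharGroup A))
    (hC : ∀ a : A, (∀ γ ∈ C, γ a = 1) → a = 1) (χ : CharGroup A) (F : Finset A) :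
    ∃ γ ∈ C, ∀ a ∈ F, γ a = χ a := by
  classical
  induction F using Finset.induction_on with
  | empty => exact ⟨1, C.one_mem, by simp⟩
  | insert b F _ ih =>
    obtain ⟨γ, hγ, hF⟩ := ih
    by_cases hb : γ b = χ b
    · exact ⟨γ, hγ, fun a ha => by
        rcases Finset.mem_insert.1 ha with rfl | ha
        · exact hb
        · exact hF a ha⟩
    have hbF : b ∉ Subgroup.closure (F : Set A) := fun h => hb
      (MonoidHom.eqOn_closure (f := γ) (g := χ) (fun a ha => hF a ha) h)
    have := mt (mem_closure_of_forall_char C hC F b) hbF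
    push Not at this
    obtain ⟨γ₀, hγ₀, hF₀, hb₀⟩ := this
    refine ⟨γ * γ₀, C.mul_mem hγ hγ₀, fun a ha => ?_⟩
    rcases Finset.mem_insert.1 ha with rfl | ha
    · rcases Int.units_eq_one_or (γ a) with h1 | h1 <;>
        rcases Int.units_eq_one_or (χ a) with h2 | h2 <;>
        rcases Int.units_eq_one_or (γ₀ a) with h3 | h3 <;> simp_all
    · simp [hF a ha, hF₀ a ha]

theorem topologicalClosure_eq_top_of_separating {A : Type*} [Group A]
    (C : Subgroup (CharGroup A)) (hC : ∀ a : A, (∀ γ ∈ C, γ a = 1) → a = 1) :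
    C.topologicalClosure = ⊤ := by
  rw [eq_top_iff]
  intro χ _
  change χ ∈ closure (C : Set (CharGroup A))
  rw [closure_induced, mem_closure_iff]
  intro U hU hχ
  obtain ⟨F, V, hV, hFV⟩ := isOpen_pi_iff.1 hU _ hχ
  obtain ⟨γ, hγ, hF⟩ := exists_mem_eqOn_finset C hC χ F
  exact ⟨γ, hFV fun a ha => by rw [hF a ha]; exact (hV a ha).2, γ, hγ, rfl⟩

/-! ### The quotient structure -/

/-- The restriction map `X → X₀`. -/
def toRestrictedPoints {G : Subgroup (X → ℤˣ)} (G₀ : Subgroup G) (x : X) :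
    restrictedPoints G₀ :=
  ⟨(evalChar G x).comp G₀.subtype, x, rfl⟩

theorem toRestrictedPoints_surjective {G : Subgroup (X → ℤˣ)} (G₀ : Subgroup G) :
    Function.Surjective (toRestrictedPoints G₀) := by
  rintro ⟨_, x, rfl⟩
  exact ⟨x, rfl⟩

/-- Pulling back the functions of the quotient structure along `X → X₀` gives `G₀`, viewed as a
group of functions on `X`. -/
theorem map_quotientStructure {G : Subgroup (X → ℤˣ)} (G₀ : Subgroup G) :
    (quotientStructure G₀).map (pullback (toRestrictedPoints G₀)) = G₀.map G.subtype := by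
  ext h
  constructor
  · rintro ⟨_, ⟨a, rfl⟩, rfl⟩
    exact ⟨a, a.2, rfl⟩
  · rintro ⟨a, ha, rfl⟩
    exact ⟨_, ⟨⟨a, ha⟩, rfl⟩, rfl⟩

theorem perp_quotientGenerators {G : Subgroup (X → ℤˣ)} (hG : IsSpaceOfOrderings G)
    (G₀ : Subgroup G) (hquot : IsSpaceOfOrderings (quotientStructure G₀)) :
    perp (quotientGenerators G₀) = (G₀ : Set G) := by
  ext g
  constructor
  · intro hg
    have hH := hquot.isPreSpace.map_pullback (toRestrictedPoints_surjective G₀)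
    rw [map_quotientStructure] at hH
    have : g.1 ∈ G₀.map G.subtype := by
      refine mem_of_four_products hG.isPreSpace hH (Subgroup.map_subtype_le G₀) g.2
        fun σ τ ρ ω h => ?_
      have hval : ∀ a : G, (∏ i, evalChar G (![σ, τ, ρ, ω] i)) a =
          a.1 σ * a.1 τ * a.1 ρ * a.1 ω := fun a => by
        rw [Fin.prod_univ_four]
        rfl
      rw [← hval]
      refine hg _ ⟨⟨_, rfl⟩, QuotientGroup.lift G₀ (∏ i, evalChar G (![σ, τ, ρ, ω] i))
        fun a ha => ?_, ?_⟩
      · exact (hval a).trans (h _ ⟨a, ha, rfl⟩)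
      · rfl
    obtain ⟨g', hg', e⟩ := this
    rwa [← Subtype.ext e]
  · rintro hg _ ⟨-, γ, rfl⟩
    change γ (g : G ⧸ G₀) = 1
    rw [(QuotientGroup.eq_one_iff g).2 hg, map_one]

end SpaceOfOrderings

open SpaceOfOrderings in
theorem mainTheorem8 {X : Type*} (G : Subgroup (X → ℤˣ)) (hG : IsSpaceOfOrderings G)
    (G₀ : Subgroup G) (hG₀ : (⟨-1, hG.neg_one_mem⟩ : G) ∈ G₀)
    (hquot : IsSpaceOfOrderings (quotientStructure G₀)) :
    (Subgroup.closure (inflate G₀ ⁻¹' quotientGenerators G₀)).topologicalClosure = ⊤ ∧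
      perp (quotientGenerators G₀) = (G₀ : Set G) := by
  have hperp := perp_quotientGenerators hG G₀ hquot
  refine ⟨topologicalClosure_eq_top_of_separating _ fun a ha => ?_, hperp⟩
  obtain ⟨g, rfl⟩ := QuotientGroup.mk_surjective a
  refine (QuotientGroup.eq_one_iff g).2 ?_
  rw [← SetLike.mem_coe, ← hperp]
  rintro _ ⟨h1, γ, rfl⟩
  exact ha γ (Subgroup.subset_closure ⟨h1, γ, rfl⟩)
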